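/- Let $p \in \mathbb{C}[z_1,\dots,z_d]$ be a polynomial with no zeros on the closed polydisk $\overline{\mathbb{D}}^d$, and let $n=(n_1,\dots,n_d)$ be a tuple of non-negative integers such that the degree of $p$ in $z_j$ is at most $n_j$ for every $j$. Let $\sigma$ be normalized Lebesgue measure on the torus $\mathbb{T}^d$ and let $d\mu = |p(z)|^{-2}\,d\sigma(z)$. For $X \subset \mathbb{Z}^d$ let $$L^2_\mu(X) = \{ f \in L^2(\mu) : \hat f(\alpha) = 0 \text{ for all } \alpha \notin X\},$$ where $\hat f(\alpha) = \int_{\mathbb{T}^d} f(z)\, \overline{z^{\alpha}}\, d\sigma(z)$ is the $\alpha$-th Fourier coefficient of $f$, and for $Y \subset X$ let $L^2_\mu(X \ominus Y)$ be the orthogonal complement of $L^2_\mu(Y)$ in $L^2_\mu(X)$ with respect to the inner product of $L^2(\mu)$. For $S \subset \{1,\dots,d\}$ let $$X_S = \{\alpha \in \mathbb{Z}^d : \alpha_k \ge 0 \text{ for all } k, \text{ and } \alpha_j < n_j \text{ for some } j \in S\}.$$ Let $S \sqcup T = \{1,\dots,d\}$ be a partition ($S$ or $T$ may be empty). Then for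 every $j \in T$ the subspace $L^2_\mu(X_S \ominus (X_S \cap X_T))$ is closed under multiplication by $z_j$: if $f$ belongs to it, then so does $z_j f$. -/

import Mathlib

open MeasureTheory
open scoped ENNReal

noncomputable section

namespace BernsteinSzego

variable {ι : Type*} [Fintype ι]

/-- Normalized Lebesgue measure `σ` on the torus; the torus is parametrized by
`t ∈ (ℝ / ℤ) ^ ι` through `z_j = exp (2 π i t_j)`. -/
def sigma (ι : Type*) [Fintype ι] : Measure (UnitAddTorus ι) :=
  Measure.pi fun _ => AddCircle.haarAddCircle

/-- The point `z = (z_j)` of `ℂ ^ ι`, `z_j = exp (2 π i t_j)`, that corresponds to `t`. -/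
def coord (t : UnitAddTorus ι) : ι → ℂ := fun j => (AddCircle.toCircle (t j) : ℂ)

/-- The density `1 / |p z| ^ 2` on the torus. -/
def weight (p : MvPolynomial ι ℂ) (t : UnitAddTorus ι) : ℝ≥0∞ :=
  (‖MvPolynomial.eval (coord t) p‖ₑ ^ 2)⁻¹

/-- The Bernstein-Szegő measure `dμ = |p|⁻² dσ`. -/
def bsMeasure (p : MvPolynomial ι ℂ) : Measure (UnitAddTorus ι) :=
  (sigma ι).withDensity (weight p)

theorem continuous_coord : Continuous (coord : UnitAddTorus ι → ι → ℂ) := by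
  refine continuous_pi fun j => ?_
  exact continuous_subtype_val.comp (AddCircle.continuous_toCircle.comp (continuous_apply j))

theorem norm_coord (t : UnitAddTorus ι) (j : ι) : ‖coord t j‖ = 1 := by
  exact Circle.norm_coe _

theorem exists_smul_sigma_le (p : MvPolynomial ι ℂ) :
    ∃ c : ℝ≥0∞, c ≠ 0 ∧ c ≠ ∞ ∧ c • sigma ι ≤ bsMeasure p := by
  have hcont : Continuous fun t : UnitAddTorus ι => MvPolynomial.eval (coord t) p :=
    (MvPolynomial.continuous_eval p).comp continuous_coord
  obtain ⟨M, hM⟩ := isCompact_univ.exists_bound_of_continuousOn hcont.continuousOn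
  have hM1 : 0 < max M 1 := lt_max_of_lt_right one_pos
  refine ⟨(ENNReal.ofReal (max M 1) ^ 2)⁻¹, by simp, by simp, ?_⟩
  rw [bsMeasure, ← withDensity_const]
  refine withDensity_mono (Filter.Eventually.of_forall fun t => ?_)
  refine ENNReal.inv_le_inv.2 (pow_le_pow_left' ?_ 2)
  rw [← ofReal_norm]
  exact ENNReal.ofReal_le_ofReal ((hM t (Set.mem_univ t)).trans (le_max_left _ _))

theorem sigma_absolutelyContinuous (p : MvPolynomial ι ℂ) : sigma ι ≪ bsMeasure p := by
  obtain ⟨c, h0, -, hle⟩ := exists_smul_sigma_le p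
  exact (Measure.absolutelyContinuous_smul h0).trans (Measure.absolutelyContinuous_of_le hle)

/-- Elements of `L²(μ)` are integrable for `σ`, so that their Fourier coefficients make sense. -/
theorem integrable_sigma {p : MvPolynomial ι ℂ} (f : Lp ℂ 2 (bsMeasure p)) :
    Integrable f (sigma ι) := by
  obtain ⟨c, h0, ht, hle⟩ := exists_smul_sigma_le p
  have h1 : MemLp f 2 (c • sigma ι) := (Lp.memLp f).mono_measure hle
  have h2 : MemLp f 2 (c⁻¹ • c • sigma ι) := h1.smul_measure (ENNReal.inv_ne_top.2 h0)
  rw [smul_smul, ENNReal.inv_mul_cancel h0 ht, one_smul] at h2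
  have : IsProbabilityMeasure (sigma ι) := by unfold sigma; infer_instance
  exact h2.integrable (by norm_num)

theorem integrable_mFourier_smul {p : MvPolynomial ι ℂ} (f : Lp ℂ 2 (bsMeasure p)) (α : ι → ℤ) :
    Integrable (fun t => UnitAddTorus.mFourier α t • f t) (sigma ι) := by
  refine (integrable_sigma f).bdd_smul 1
    (UnitAddTorus.mFourier α).continuous.aestronglyMeasurable
    (Filter.Eventually.of_forall fun t => ?_)
  exact ((UnitAddTorus.mFourier α).norm_coe_le_norm t).trans UnitAddTorus.mFourier_norm.le

/-- `∫ f z^{-α} dσ` -/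
theorem mFourierCoeff_eq (f : UnitAddTorus ι → ℂ) (α : ι → ℤ) :
    UnitAddTorus.mFourierCoeff f α = ∫ t, UnitAddTorus.mFourier (-α) t • f t ∂(sigma ι) := rfl

/-- `L²_μ(X)`: the elements of `L²(μ)` whose Fourier coefficients (with respect to `σ`)
vanish outside `X`. -/
def L2 (p : MvPolynomial ι ℂ) (X : Set (ι → ℤ)) : Submodule ℂ (Lp ℂ 2 (bsMeasure p)) where
  carrier := {f | ∀ α, α ∉ X → UnitAddTorus.mFourierCoeff f α = 0}
  zero_mem' := by
    intro α _
    rw [mFourierCoeff_eq]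
    refine integral_eq_zero_of_ae ?_
    filter_upwards [(sigma_absolutelyContinuous p).ae_le (Lp.coeFn_zero ℂ 2 (bsMeasure p))]
      with t ht
    rw [ht]; simp
  add_mem' := by
    intro f g hf hg α hα
    have h1 := hf α hα
    have h2 := hg α hα
    rw [mFourierCoeff_eq] at h1 h2 ⊢
    rw [← add_zero (0 : ℂ)]
    nth_rewrite 1 [← h1]
    rw [← h2, ← integral_add (integrable_mFourier_smul f _) (integrable_mFourier_smul g _)]
    refine integral_congr_ae ?_
    filter_upwards [(sigma_absolutelyContinuous p).ae_le (Lp.coeFn_add f g)] with t ht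
    rw [ht, Pi.add_apply, smul_add]
  smul_mem' := by
    intro c f hf α hα
    have h1 := hf α hα
    rw [mFourierCoeff_eq] at h1 ⊢
    refine Eq.trans ?_ ((congrArg (c • ·) h1).trans (smul_zero c))
    refine Eq.trans ?_ (integral_smul c _)
    refine integral_congr_ae ?_
    filter_upwards [(sigma_absolutelyContinuous p).ae_le (Lp.coeFn_smul c f)] with t ht
    rw [ht, Pi.smul_apply, smul_comm]

/-- `L²_μ(X ⊖ Y) = L²_μ(X) ⊖ L²_μ(Y)`, the orthogonal complement being taken in `L²(μ)`. -/
def L2Diff (p : MvPolynomial ι ℂ) (X Y : Set (ι → ℤ)) : Submodule ℂ (Lp ℂ 2 (bsMeasure p)) :=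
  L2 p X ⊓ (L2 p Y)ᗮ

/-- `X_S`: the `α ≥ 0` in `ℤ ^ ι` such that `α_j < n_j` for some `j ∈ S`. -/
def XSet (n : ι → ℕ) (S : Set ι) : Set (ι → ℤ) :=
  {α | 0 ≤ α ∧ ∃ j ∈ S, α j < (n j : ℤ)}

theorem memLp_mul {p : MvPolynomial ι ℂ} (j : ι) (f : Lp ℂ 2 (bsMeasure p)) :
    MemLp (fun t => coord t j * f t) 2 (bsMeasure p) := by
  refine (Lp.memLp f).of_le ?_ (Filter.Eventually.of_forall fun t => ?_)
  · exact ((continuous_apply j).comp continuous_coord).aestronglyMeasurable.mul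
      (Lp.aestronglyMeasurable f)
  · rw [norm_mul, norm_coord, one_mul]

/-- Multiplication by the variable `z_j` on `L²(μ)`. -/
def mulVar {p : MvPolynomial ι ℂ} (j : ι) (f : Lp ℂ 2 (bsMeasure p)) : Lp ℂ 2 (bsMeasure p) :=
  (memLp_mul j f).toLp fun t => coord t j * f t

end BernsteinSzego

end

noncomputable section

namespace BernsteinSzego

open UnitAddTorus
open scoped ComplexConjugate InnerProductSpace

variable {ι : Type*} [Fintype ι]

/-! Put `q = 1/p` and `g = |q|² f`, so that orthogonality to `f` in L²(μ) is orthogonality to `g` in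
L²(σ). The hypothesis on `f` says that the coefficients of `g` vanish on X_S ∩ X_T. For `h`
supported there, ⟨h, z_j f⟩_μ = ⟨z_j⁻¹ h, g⟩_σ, and z_j⁻¹ h may have negative frequencies in the
direction j ∈ T. Hence the coefficients of `g` must also vanish at such frequencies, which is
`inner_eq_zero_of_orthogonal`.

Let A be the set of frequencies that are nonnegative on S and short in some direction of S, with no
condition on T. The compression of |q|² to A has an explicit inverse R, `bsKernel`, of
Christoffel-Darboux type. It is positive definite, and it lowers frequencies in each direction k ∈ T
by at most n_k. On A, the function `g` splits into g₁, with some negative T-frequency, and g₂, with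
every T-frequency at least n_k; all other coefficients vanish by hypothesis. From R g = f it follows
that R g₁ = f - R g₂ is analytic in the directions of T, hence orthogonal to g₁. Positivity
(`eq_zero_of_inner_bsKernel`) gives g₁ = 0. -/

/-! ### Multiplication operators and Fourier supports in L²(σ) -/

instance isProbabilityMeasure_sigma : IsProbabilityMeasure (sigma ι) := by
  unfold sigma; infer_instance

/-- The Hilbert basis of monomials of `L²(σ)`. -/
def monomialBasis (ι : Type*) [Fintype ι] : HilbertBasis (ι → ℤ) ℂ (Lp ℂ 2 (sigma ι)) :=
  mFourierBasis

theorem coeFn_monomialBasis (α : ι → ℤ) : monomialBasis ι α =ᵐ[sigma ι] mFourier α := by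
  have : monomialBasis ι α = mFourierLp 2 α := congrFun coe_mFourierBasis α
  rw [this]
  exact coeFn_mFourierLp 2 α

theorem inner_monomialBasis (f : Lp ℂ 2 (sigma ι)) (α : ι → ℤ) :
    ⟪monomialBasis ι α, f⟫_ℂ = mFourierCoeff f α := by
  rw [← HilbertBasis.repr_apply_apply]
  exact mFourierBasis_repr f α

/-- Multiplication by a continuous function on `L²(σ)`. -/
def torusMul : C(UnitAddTorus ι, ℂ) →L[ℂ] Lp ℂ 2 (sigma ι) →L[ℂ] Lp ℂ 2 (sigma ι) :=
  ((ContinuousLinearMap.mul ℂ ℂ).holderL (sigma ι) ∞ 2 2).comp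
    (ContinuousMap.toLp ∞ (sigma ι) ℂ)

theorem coeFn_torusMul (φ : C(UnitAddTorus ι, ℂ)) (f : Lp ℂ 2 (sigma ι)) :
    torusMul φ f =ᵐ[sigma ι] fun t => φ t * f t := by
  filter_upwards [(ContinuousLinearMap.mul ℂ ℂ).coeFn_holder (r := 2)
    (ContinuousMap.toLp ∞ (sigma ι) ℂ φ) f, ContinuousMap.coeFn_toLp (p := ∞) (𝕜 := ℂ) (sigma ι) φ]
    with t h1 h2
  refine h1.trans ?_
  rw [h2]
  rfl

theorem torusMul_mul (φ ψ : C(UnitAddTorus ι, ℂ)) (f : Lp ℂ 2 (sigma ι)) :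
    torusMul (φ * ψ) f = torusMul φ (torusMul ψ f) := by
  refine Lp.ext ?_
  filter_upwards [coeFn_torusMul (φ * ψ) f, coeFn_torusMul φ (torusMul ψ f), coeFn_torusMul ψ f]
    with t h1 h2 h3
  rw [h1, h2, h3, ContinuousMap.mul_apply, mul_assoc]

theorem torusMul_one (f : Lp ℂ 2 (sigma ι)) : torusMul 1 f = f := by
  refine Lp.ext ?_
  filter_upwards [coeFn_torusMul 1 f] with t h1
  rw [h1, ContinuousMap.one_apply, one_mul]

theorem inner_torusMul_left (φ : C(UnitAddTorus ι, ℂ)) (f g : Lp ℂ 2 (sigma ι)) :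
    ⟪torusMul φ f, g⟫_ℂ = ⟪f, torusMul (star φ) g⟫_ℂ := by
  rw [L2.inner_def, L2.inner_def]
  refine integral_congr_ae ?_
  filter_upwards [coeFn_torusMul φ f, coeFn_torusMul (star φ) g] with t h1 h2
  rw [h1, h2]
  simp only [RCLike.inner_apply, map_mul, ContinuousMap.star_apply, RCLike.star_def]
  ring

theorem inner_torusMul_right (φ : C(UnitAddTorus ι, ℂ)) (f g : Lp ℂ 2 (sigma ι)) :
    ⟪f, torusMul φ g⟫_ℂ = ⟪torusMul (star φ) f, g⟫_ℂ := by
  rw [inner_torusMul_left, star_star]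

theorem torusMul_monomialBasis (α β : ι → ℤ) :
    torusMul (mFourier α) (monomialBasis ι β) = monomialBasis ι (α + β) := by
  refine Lp.ext ?_
  filter_upwards [coeFn_torusMul (mFourier α) (monomialBasis ι β), coeFn_monomialBasis β,
    coeFn_monomialBasis (α + β)] with t h1 h2 h3
  rw [h1, h2, h3, mFourier_add]

theorem star_mFourier (α : ι → ℤ) : star (mFourier α) = mFourier (-α) := by
  ext t
  rw [mFourier_neg]
  rfl

/-- The elements of `L²(σ)` whose Fourier coefficients vanish outside `X`. -/
def suppOn (X : Set (ι → ℤ)) : Submodule ℂ (Lp ℂ 2 (sigma ι)) :=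
  (Submodule.span ℂ (monomialBasis ι '' Xᶜ))ᗮ

theorem mem_suppOn {X : Set (ι → ℤ)} {f : Lp ℂ 2 (sigma ι)} :
    f ∈ suppOn X ↔ ∀ α ∉ X, ⟪monomialBasis ι α, f⟫_ℂ = 0 := by
  rw [suppOn, Submodule.mem_orthogonal]
  refine ⟨fun h α hα => h _ (Submodule.subset_span ⟨α, hα, rfl⟩), fun h u hu => ?_⟩
  induction hu using Submodule.span_induction with
  | mem x hx => obtain ⟨α, hα, rfl⟩ := hx; exact h α hα
  | zero => exact inner_zero_left _
  | add x y _ _ hx hy => rw [inner_add_left, hx, hy, add_zero]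
  | smul c x _ hx => rw [inner_smul_left, hx, mul_zero]

instance hasOrthogonalProjection_suppOn (X : Set (ι → ℤ)) : (suppOn X).HasOrthogonalProjection := by
  unfold suppOn; infer_instance

theorem isClosed_suppOn (X : Set (ι → ℤ)) : IsClosed (suppOn X : Set (Lp ℂ 2 (sigma ι))) :=
  Submodule.isClosed_orthogonal _

theorem monomialBasis_mem_suppOn {X : Set (ι → ℤ)} {α : ι → ℤ} (hα : α ∈ X) :
    monomialBasis ι α ∈ suppOn X :=
  mem_suppOn.2 fun _ hβ => (monomialBasis ι).orthonormal.2 fun h => hβ (h ▸ hα)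

theorem suppOn_mono {X Y : Set (ι → ℤ)} (h : X ⊆ Y) : suppOn X ≤ suppOn Y :=
  fun _ hf => mem_suppOn.2 fun α hα => mem_suppOn.1 hf α fun h' => hα (h h')

theorem suppOn_inter {X Y : Set (ι → ℤ)} {f : Lp ℂ 2 (sigma ι)} (hX : f ∈ suppOn X)
    (hY : f ∈ suppOn Y) : f ∈ suppOn (X ∩ Y) :=
  mem_suppOn.2 fun α hα => by
    by_cases h : α ∈ X
    · exact mem_suppOn.1 hY α fun h' => hα ⟨h, h'⟩
    · exact mem_suppOn.1 hX α h

theorem inner_eq_zero_of_forall {f g : Lp ℂ 2 (sigma ι)}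
    (h : ∀ α, ⟪monomialBasis ι α, f⟫_ℂ = 0 ∨ ⟪monomialBasis ι α, g⟫_ℂ = 0) : ⟪f, g⟫_ℂ = 0 := by
  rw [← (monomialBasis ι).tsum_inner_mul_inner f g]
  convert tsum_zero with α
  rcases h α with h | h
  · rw [inner_eq_zero_symm.1 h, zero_mul]
  · rw [h, mul_zero]

theorem inner_eq_zero_of_disjoint {X Y : Set (ι → ℤ)} (hXY : Disjoint X Y)
    {f g : Lp ℂ 2 (sigma ι)} (hf : f ∈ suppOn X) (hg : g ∈ suppOn Y) : ⟪f, g⟫_ℂ = 0 :=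
  inner_eq_zero_of_forall fun α => by
    by_cases h : α ∈ X
    · exact .inr (mem_suppOn.1 hg α fun h' => Set.disjoint_left.1 hXY h h')
    · exact .inl (mem_suppOn.1 hf α h)

/-- The projection onto `suppOn X` truncates the Fourier series. -/
theorem inner_monomialBasis_proj_of_mem {X : Set (ι → ℤ)} (f : Lp ℂ 2 (sigma ι)) {α : ι → ℤ}
    (hα : α ∈ X) :
    ⟪monomialBasis ι α, (suppOn X).starProjection f⟫_ℂ = ⟪monomialBasis ι α, f⟫_ℂ := by
  rw [← Submodule.inner_starProjection_left_eq_right,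
    Submodule.starProjection_eq_self_iff.2 (monomialBasis_mem_suppOn hα)]

theorem inner_monomialBasis_proj_of_notMem {X : Set (ι → ℤ)} (f : Lp ℂ 2 (sigma ι)) {α : ι → ℤ}
    (hα : α ∉ X) : ⟪monomialBasis ι α, (suppOn X).starProjection f⟫_ℂ = 0 :=
  mem_suppOn.1 (Submodule.starProjection_apply_mem _ _) α hα

theorem proj_mem_suppOn {X Y : Set (ι → ℤ)} {f : Lp ℂ 2 (sigma ι)} (hf : f ∈ suppOn Y) :
    (suppOn X).starProjection f ∈ suppOn Y :=
  mem_suppOn.2 fun α hα => by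
    by_cases h : α ∈ X
    · rw [inner_monomialBasis_proj_of_mem f h, mem_suppOn.1 hf α hα]
    · exact inner_monomialBasis_proj_of_notMem f h

theorem proj_eq_zero {X Y : Set (ι → ℤ)} (hXY : Disjoint X Y) {f : Lp ℂ 2 (sigma ι)}
    (hf : f ∈ suppOn Y) : (suppOn X).starProjection f = 0 := by
  have h := inner_eq_zero_of_disjoint hXY (Submodule.starProjection_apply_mem (suppOn X) f)
    (proj_mem_suppOn (X := X) hf)
  exact inner_self_eq_zero.1 h

theorem sub_proj_mem_suppOn_compl (X : Set (ι → ℤ)) (f : Lp ℂ 2 (sigma ι)) :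
    f - (suppOn X).starProjection f ∈ suppOn Xᶜ :=
  mem_suppOn.2 fun α hα => by
    rw [inner_sub_right, inner_monomialBasis_proj_of_mem f (not_not.1 hα), sub_self]

theorem torusMul_mFourier_mem {X Y : Set (ι → ℤ)} {β : ι → ℤ} (h : ∀ α ∈ X, β + α ∈ Y)
    {f : Lp ℂ 2 (sigma ι)} (hf : f ∈ suppOn X) : torusMul (mFourier β) f ∈ suppOn Y :=
  mem_suppOn.2 fun α hα => by
    rw [inner_torusMul_right, star_mFourier, torusMul_monomialBasis]
    exact mem_suppOn.1 hf _ fun h' => hα (by simpa using h _ h')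

/-! ### Polynomials as multipliers -/

/-- The restriction of a polynomial to the torus. -/
def polyMap : MvPolynomial ι ℂ →ₐ[ℂ] C(UnitAddTorus ι, ℂ) :=
  MvPolynomial.aeval fun j => ⟨fun t => coord t j, (continuous_apply j).comp continuous_coord⟩

theorem polyMap_apply (p : MvPolynomial ι ℂ) (t : UnitAddTorus ι) :
    polyMap p t = MvPolynomial.eval (coord t) p := by
  have : ((ContinuousMap.evalAlgHom ℂ ℂ t).comp polyMap) = MvPolynomial.aeval (coord t) := by
    ext j
    simp [polyMap]
  rw [← MvPolynomial.coe_aeval_eq_eval]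
  exact DFunLike.congr_fun this p

theorem coord_eq_mFourier [DecidableEq ι] (t : UnitAddTorus ι) (j : ι) :
    coord t j = mFourier (Pi.single j 1) t := by
  rw [mFourier_single, fourier_one]; rfl

theorem polyMap_X [DecidableEq ι] (j : ι) :
    polyMap (MvPolynomial.X j) = mFourier (Pi.single j (1 : ℤ)) := by
  ext t
  rw [polyMap_apply, MvPolynomial.eval_X, coord_eq_mFourier]

theorem polyMap_monomial (m : ι →₀ ℕ) (c : ℂ) :
    polyMap (MvPolynomial.monomial m c) = c • mFourier fun j => (m j : ℤ) := by
  ext t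
  rw [polyMap_apply, MvPolynomial.eval_monomial, ContinuousMap.smul_apply, smul_eq_mul,
    Finsupp.prod_fintype _ _ (by simp), mFourier, ContinuousMap.coe_mk]
  congr 1
  refine Finset.prod_congr rfl fun j _ => ?_
  rw [fourier_apply, natCast_zsmul, AddCircle.toCircle_nsmul, Circle.coe_pow]
  rfl

theorem torusMul_polyMap_mem {X Y : Set (ι → ℤ)} {p : MvPolynomial ι ℂ} {n : ι → ℕ}
    (hdeg : ∀ j, p.degreeOf j ≤ n j)
    (h : ∀ α ∈ X, ∀ β : ι → ℤ, 0 ≤ β → (∀ j, β j ≤ n j) → α + β ∈ Y)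
    {f : Lp ℂ 2 (sigma ι)} (hf : f ∈ suppOn X) : torusMul (polyMap p) f ∈ suppOn Y := by
  rw [p.as_sum, map_sum, map_sum, sum_apply]
  refine Submodule.sum_mem _ fun m hm => ?_
  rw [polyMap_monomial, map_smul, smul_apply]
  refine Submodule.smul_mem _ _ (torusMul_mFourier_mem (fun α hα => ?_) hf)
  rw [add_comm]
  refine h α hα _ (fun j => by simp) fun j => ?_
  exact_mod_cast (MvPolynomial.monomial_le_degreeOf j hm).trans (hdeg j)

/-- Multiplication by p̄ is the adjoint of multiplication by p, so this is dual to
`torusMul_polyMap_mem` applied to single monomials. -/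
theorem torusMul_star_polyMap_mem {X Y : Set (ι → ℤ)} {p : MvPolynomial ι ℂ} {n : ι → ℕ}
    (hdeg : ∀ j, p.degreeOf j ≤ n j)
    (h : ∀ α ∈ X, ∀ β : ι → ℤ, 0 ≤ β → (∀ j, β j ≤ n j) → α - β ∈ Y)
    {f : Lp ℂ 2 (sigma ι)} (hf : f ∈ suppOn X) : torusMul (star (polyMap p)) f ∈ suppOn Y := by
  refine mem_suppOn.2 fun α hα => ?_
  rw [inner_torusMul_right, star_star]
  refine inner_eq_zero_of_disjoint (X := Xᶜ) disjoint_compl_left ?_ hf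
  refine torusMul_polyMap_mem (X := {α}) hdeg ?_ (monomialBasis_mem_suppOn rfl)
  rintro _ rfl β h0 h1 hmem
  exact hα (by simpa using h _ hmem β h0 h1)

/-! ### Inverting a polynomial without zeros on the closed polydisk -/

/-- The continuous functions `φ` on the torus with `φ V ⊆ V`. -/
def multiplierAlgebra (V : Submodule ℂ (Lp ℂ 2 (sigma ι))) : Subalgebra ℂ C(UnitAddTorus ι, ℂ) where
  carrier := {φ | ∀ f ∈ V, torusMul φ f ∈ V}
  mul_mem' ha hb f hf := by rw [torusMul_mul]; exact ha _ (hb f hf)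
  add_mem' ha hb f hf := by
    rw [map_add, add_apply]; exact V.add_mem (ha f hf) (hb f hf)
  algebraMap_mem' c f hf := by
    rw [Algebra.algebraMap_eq_smul_one, map_smul, smul_apply, torusMul_one]
    exact V.smul_mem c hf

/-- Closedness makes the multipliers a commutative Banach algebra, to which Gelfand theory applies.
-/
theorem isClosed_multiplierAlgebra {V : Submodule ℂ (Lp ℂ 2 (sigma ι))}
    (hV : IsClosed (V : Set (Lp ℂ 2 (sigma ι)))) :
    IsClosed (multiplierAlgebra V : Set C(UnitAddTorus ι, ℂ)) := by
  have : (multiplierAlgebra V : Set C(UnitAddTorus ι, ℂ))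
      = ⋂ f ∈ V, (fun φ => torusMul φ f) ⁻¹' (V : Set (Lp ℂ 2 (sigma ι))) := by
    ext φ
    simp [multiplierAlgebra]
  rw [this]
  exact isClosed_biInter fun f _ => hV.preimage (by fun_prop)

/-- A polynomial without zeros on the closed polydisk takes invertible values at tuples of
contractions in a commutative Banach algebra. -/
theorem isUnit_aeval {ι B : Type*} [NormedCommRing B] [NormedAlgebra ℂ B] [CompleteSpace B]
    [NormOneClass B] {p : MvPolynomial ι ℂ}
    (hp : ∀ z : ι → ℂ, (∀ j, ‖z j‖ ≤ 1) → MvPolynomial.eval z p ≠ 0)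
    (x : ι → B) (hx : ∀ j, ‖x j‖ ≤ 1) : IsUnit (MvPolynomial.aeval x p) := by
  by_contra hn
  -- A non-unit is killed by some character. Characters are contractive, so the images of the `x j`
  -- form a zero of p in the closed polydisk.
  obtain ⟨χ, hχ⟩ := WeakDual.CharacterSpace.exists_apply_eq_zero hn
  let ψ : B →ₐ[ℂ] ℂ := WeakDual.CharacterSpace.equivAlgHom χ
  refine hp (fun j => ψ (x j)) (fun j => (AlgHom.norm_apply_le_self ψ _).trans (hx j)) ?_
  have hψ : ψ.comp (MvPolynomial.aeval x) = MvPolynomial.aeval fun j => ψ (x j) := by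
    ext1 j
    simp
  rw [← MvPolynomial.coe_aeval_eq_eval]
  exact (DFunLike.congr_fun hψ p).symm.trans hχ

/-- A polynomial without zeros on the closed polydisk is invertible in every closed algebra of
multipliers that contains the variables. -/
theorem exists_inverse_mem_multiplierAlgebra {p : MvPolynomial ι ℂ}
    (hp : ∀ z : ι → ℂ, (∀ j, ‖z j‖ ≤ 1) → MvPolynomial.eval z p ≠ 0)
    {V : Submodule ℂ (Lp ℂ 2 (sigma ι))} (hV : IsClosed (V : Set (Lp ℂ 2 (sigma ι))))
    (hX : ∀ j, polyMap (MvPolynomial.X j) ∈ multiplierAlgebra V) :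
    ∃ q ∈ multiplierAlgebra V, polyMap p * q = 1 := by
  have : CompleteSpace (multiplierAlgebra V) := (isClosed_multiplierAlgebra hV).completeSpace_coe
  have : NormOneClass (multiplierAlgebra V) := ⟨norm_one (α := C(UnitAddTorus ι, ℂ))⟩
  let x : ι → multiplierAlgebra V := fun j => ⟨polyMap (MvPolynomial.X j), hX j⟩
  have hx : ∀ j, ‖x j‖ ≤ 1 := fun j => by
    refine (ContinuousMap.norm_le _ zero_le_one).2 fun t => ?_
    change ‖polyMap (MvPolynomial.X j) t‖ ≤ 1
    rw [polyMap_apply, MvPolynomial.eval_X, norm_coord]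
  have hF : (multiplierAlgebra V).val.comp (MvPolynomial.aeval x) = polyMap := by
    ext1 j
    simp [x]
  obtain ⟨q, hq⟩ := (isUnit_aeval hp x hx).exists_right_inv
  refine ⟨q, q.2, ?_⟩
  rw [← hF]
  exact congrArg Subtype.val hq

/-! ### The inverse of a compression of `|p|⁻²` -/

/-- The frequencies that are nonnegative in the directions of `S`. -/
def nonnegOn (S : Set ι) : Set (ι → ℤ) := {α | ∀ k ∈ S, 0 ≤ α k}

/-- The frequencies `α` with `α k < n k` for some direction `k ∈ S`. -/
def shortOn (n : ι → ℕ) (S : Set ι) : Set (ι → ℤ) := {α | ∃ k ∈ S, α k < n k}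

theorem XSet_eq {κ : Type*} (n : κ → ℕ) (S : Set κ) : XSet n S = nonnegOn Set.univ ∩ shortOn n S := by
  ext α
  simp [XSet, nonnegOn, shortOn, Pi.le_def]

open Classical in
/-- The monomial `∏ k ∈ S, z_k ^ n_k`. -/
def topMonomial (n : ι → ℕ) (S : Set ι) : C(UnitAddTorus ι, ℂ) :=
  mFourier (S.indicator fun k => (n k : ℤ))

theorem topMonomial_mul_star (n : ι → ℕ) (S : Set ι) :
    topMonomial n S * star (topMonomial n S) = 1 := by
  ext t
  rw [topMonomial, star_mFourier, ContinuousMap.mul_apply, ← mFourier_add, add_neg_cancel,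
    mFourier_zero]

theorem torusMul_topMonomial_mem {n : ι → ℕ} {S : Set ι} {X Y : Set (ι → ℤ)}
    (h : ∀ α ∈ X, (S.indicator fun k => (n k : ℤ)) + α ∈ Y)
    {f : Lp ℂ 2 (sigma ι)} (hf : f ∈ suppOn X) : torusMul (topMonomial n S) f ∈ suppOn Y :=
  torusMul_mFourier_mem h hf

theorem torusMul_star_topMonomial_mem {n : ι → ℕ} {S : Set ι} {X Y : Set (ι → ℤ)}
    (h : ∀ α ∈ X, α - (S.indicator fun k => (n k : ℤ)) ∈ Y)
    {f : Lp ℂ 2 (sigma ι)} (hf : f ∈ suppOn X) : torusMul (star (topMonomial n S)) f ∈ suppOn Y := by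
  rw [topMonomial, star_mFourier]
  exact torusMul_mFourier_mem (fun α hα => by rw [neg_add_eq_sub]; exact h α hα) hf

/-- The operator `p P p̄ - w p̄ P w̄ p` on `L²(σ)`, where `P` is the projection onto the functions
that are analytic in the directions of `S` and `w` is the monomial `∏ k ∈ S, z_k ^ n_k`. It inverts
the compression of `|p|⁻²` to the space of the frequencies `nonnegOn S ∩ shortOn n S`. -/
def bsKernel (p : MvPolynomial ι ℂ) (n : ι → ℕ) (S : Set ι) :
    Lp ℂ 2 (sigma ι) →L[ℂ] Lp ℂ 2 (sigma ι) :=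
  torusMul (polyMap p) ∘L (suppOn (nonnegOn S)).starProjection ∘L torusMul (star (polyMap p)) -
    torusMul (topMonomial n S) ∘L torusMul (star (polyMap p)) ∘L
      (suppOn (nonnegOn S)).starProjection ∘L
      torusMul (polyMap p) ∘L torusMul (star (topMonomial n S))

theorem bsKernel_apply (p : MvPolynomial ι ℂ) (n : ι → ℕ) (S : Set ι) (g : Lp ℂ 2 (sigma ι)) :
    bsKernel p n S g = torusMul (polyMap p) ((suppOn (nonnegOn S)).starProjection
        (torusMul (star (polyMap p)) g)) -
      torusMul (topMonomial n S) (torusMul (star (polyMap p))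
        ((suppOn (nonnegOn S)).starProjection
          (torusMul (polyMap p) (torusMul (star (topMonomial n S)) g)))) := rfl

theorem inner_bsKernel_left (p : MvPolynomial ι ℂ) (n : ι → ℕ) (S : Set ι)
    (f g : Lp ℂ 2 (sigma ι)) : ⟪bsKernel p n S f, g⟫_ℂ = ⟪f, bsKernel p n S g⟫_ℂ := by
  simp only [bsKernel_apply, inner_sub_left, inner_sub_right, inner_torusMul_left, star_star,
    Submodule.inner_starProjection_left_eq_right]

/-- `bsKernel` in terms of the complementary projection. -/
theorem bsKernel_apply_eq_compl (p : MvPolynomial ι ℂ) (n : ι → ℕ) (S : Set ι)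
    (g : Lp ℂ 2 (sigma ι)) : ∃ u ∈ suppOn (nonnegOn S)ᶜ, ∃ v ∈ suppOn (nonnegOn S)ᶜ,
    bsKernel p n S g = torusMul (topMonomial n S) (torusMul (star (polyMap p)) u) -
      torusMul (polyMap p) v := by
  refine ⟨_, sub_proj_mem_suppOn_compl (nonnegOn S)
    (torusMul (polyMap p) (torusMul (star (topMonomial n S)) g)), _,
    sub_proj_mem_suppOn_compl (nonnegOn S) (torusMul (star (polyMap p)) g), ?_⟩
  -- Without the projections both terms of the kernel are multiplication by |p|², since w w̄ = 1.
  -- They cancel, which allows P to be replaced by P - 1.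
  have h : torusMul (topMonomial n S) (torusMul (star (polyMap p))
      (torusMul (polyMap p) (torusMul (star (topMonomial n S)) g))) =
      torusMul (polyMap p) (torusMul (star (polyMap p)) g) := by
    simp only [← torusMul_mul]
    congr 2
    linear_combination (polyMap p * star (polyMap p)) * topMonomial_mul_star n S
  rw [bsKernel_apply, map_sub, map_sub, map_sub, h]
  abel

/-! ### Fourier supports of the range of `bsKernel` -/

section Support

variable {p : MvPolynomial ι ℂ} {n : ι → ℕ} {S T : Set ι}

/-- The two forms of the kernel give the two conditions. With P, the range is analytic on S, because
w makes up for the loss of at most n_k caused by p̄. With 1 - P, some S-frequency starts negative,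
and w or p raises it by at most n_k. -/
theorem bsKernel_mem (hdeg : ∀ j, p.degreeOf j ≤ n j) (g : Lp ℂ 2 (sigma ι)) :
    bsKernel p n S g ∈ suppOn (nonnegOn S ∩ shortOn n S) := by
  refine suppOn_inter ?_ ?_
  · rw [bsKernel_apply]
    refine Submodule.sub_mem _ ?_ ?_
    · refine torusMul_polyMap_mem hdeg (fun α hα β h0 _ => ?_)
        (Submodule.starProjection_apply_mem (suppOn (nonnegOn S)) _)
      intro k hk
      exact add_nonneg (hα k hk) (h0 k)
    · refine torusMul_topMonomial_mem (X := {α | ∀ k ∈ S, -(n k : ℤ) ≤ α k})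
        (fun α hα => ?_) (torusMul_star_polyMap_mem hdeg (fun α hα β _ h1 => ?_)
          (Submodule.starProjection_apply_mem (suppOn (nonnegOn S)) _))
      · intro k hk
        have := hα k hk
        rw [Pi.add_apply, Set.indicator_of_mem hk]
        lia
      · intro k hk
        have := hα k hk
        have := h1 k
        rw [Pi.sub_apply]
        lia
  · obtain ⟨u, hu, v, hv, h⟩ := bsKernel_apply_eq_compl p n S g
    rw [h]
    refine Submodule.sub_mem _ ?_ ?_
    · refine torusMul_topMonomial_mem (X := (nonnegOn S)ᶜ) (fun α hα => ?_)
        (torusMul_star_polyMap_mem hdeg (fun α hα β h0 _ => ?_) hu)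
      · simp only [nonnegOn, Set.mem_compl_iff, Set.mem_ofPred_eq, not_forall, not_le] at hα
        obtain ⟨k, hk, hlt⟩ := hα
        refine ⟨k, hk, ?_⟩
        rw [Pi.add_apply, Set.indicator_of_mem hk]
        lia
      · refine fun h' => hα fun k hk => ?_
        have := h' k hk
        have := h0 k
        simp only [Pi.sub_apply, Pi.zero_apply] at *
        lia
    · refine torusMul_polyMap_mem hdeg (fun α hα β _ h1 => ?_) hv
      simp only [nonnegOn, Set.mem_compl_iff, Set.mem_ofPred_eq, not_forall, not_le] at hα
      obtain ⟨k, hk, hlt⟩ := hα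
      refine ⟨k, hk, ?_⟩
      have := h1 k
      rw [Pi.add_apply]
      lia

/-- In the directions of T only p and p̄ act, as w does not involve them and P merely truncates.
Each term contains p̄ once, so frequencies drop by at most n_k. -/
theorem bsKernel_mem_nonnegOn (hdeg : ∀ j, p.degreeOf j ≤ n j) (hST : Disjoint S T)
    {g : Lp ℂ 2 (sigma ι)} (hg : g ∈ suppOn {α | ∀ k ∈ T, n k ≤ α k}) :
    bsKernel p n S g ∈ suppOn (nonnegOn T) := by
  rw [bsKernel_apply]
  refine Submodule.sub_mem _ ?_ ?_
  · refine torusMul_polyMap_mem (X := nonnegOn T) hdeg (fun α hα β h0 _ => ?_)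
      (proj_mem_suppOn (torusMul_star_polyMap_mem hdeg (fun α hα β _ h1 => ?_) hg))
    · intro k hk
      exact add_nonneg (hα k hk) (h0 k)
    · intro k hk
      have := hα k hk
      have := h1 k
      rw [Pi.sub_apply]
      lia
  · refine torusMul_topMonomial_mem (X := nonnegOn T) (fun α hα => ?_)
      (torusMul_star_polyMap_mem (X := {α | ∀ k ∈ T, n k ≤ α k}) hdeg
        (fun α hα β _ h1 => ?_)
        (proj_mem_suppOn (torusMul_polyMap_mem (X := {α | ∀ k ∈ T, n k ≤ α k}) hdeg
          (fun α hα β h0 _ => ?_) (torusMul_star_topMonomial_mem (fun α hα => ?_) hg))))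
    · intro k hk
      rw [Pi.add_apply, Set.indicator_of_notMem (Set.disjoint_right.1 hST hk), zero_add]
      exact hα k hk
    · intro k hk
      have := hα k hk
      have := h1 k
      rw [Pi.sub_apply]
      lia
    · intro k hk
      have := hα k hk
      have := h0 k
      simp only [Pi.add_apply, Pi.zero_apply] at *
      lia
    · intro k hk
      rw [Pi.sub_apply, Set.indicator_of_notMem (Set.disjoint_right.1 hST hk), sub_zero]
      exact hα k hk

end Support

/-- The adjoint of an operator preserving a subspace preserves its orthogonal complement. -/
theorem torusMul_star_mem_suppOn_compl {X : Set (ι → ℤ)} {q : C(UnitAddTorus ι, ℂ)}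
    (hq : q ∈ multiplierAlgebra (suppOn X)) {f : Lp ℂ 2 (sigma ι)} (hf : f ∈ suppOn Xᶜ) :
    torusMul (star q) f ∈ suppOn Xᶜ :=
  mem_suppOn.2 fun α hα => by
    rw [inner_torusMul_right, star_star]
    exact inner_eq_zero_of_disjoint disjoint_compl_right
      (hq _ (monomialBasis_mem_suppOn (not_not.1 hα))) hf

/-! ### The kernel as a positive definite inverse -/

section Inverse

variable {p : MvPolynomial ι ℂ} {n : ι → ℕ} {S T : Set ι} {q : C(UnitAddTorus ι, ℂ)}

/-- `bsKernel` is a left inverse of the compression of `|p|⁻²`. -/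
theorem bsKernel_torusMul (hpq : polyMap p * q = 1)
    (hq : q ∈ multiplierAlgebra (suppOn (nonnegOn S)))
    {f : Lp ℂ 2 (sigma ι)} (hf : f ∈ suppOn (nonnegOn S ∩ shortOn n S)) :
    bsKernel p n S (torusMul (star q * q) f) = f := by
  have hpq' : star (polyMap p) * star q = 1 := by
    ext t
    simpa using congrArg star (DFunLike.congr_fun hpq t)
  have h1 : torusMul (star (polyMap p)) (torusMul (star q * q) f) = torusMul q f := by
    rw [← torusMul_mul, ← mul_assoc, hpq', one_mul]
  have h2 : torusMul (polyMap p) (torusMul (star (topMonomial n S)) (torusMul (star q * q) f)) =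
      torusMul (star q) (torusMul (star (topMonomial n S)) f) := by
    simp only [← torusMul_mul]
    congr 2
    linear_combination (star (topMonomial n S) * star q) * hpq
  have h3 : torusMul (star (topMonomial n S)) f ∈ suppOn (nonnegOn S)ᶜ := by
    refine torusMul_star_topMonomial_mem (X := shortOn n S) ?_
      (suppOn_mono Set.inter_subset_right hf)
    rintro α ⟨k, hk, hlt⟩ h
    have := h k hk
    rw [Pi.sub_apply, Set.indicator_of_mem hk] at this
    lia
  -- P kills q̄ w̄ f and fixes q f, so only p q f = f remains.
  rw [bsKernel_apply, h1, h2, proj_eq_zero disjoint_compl_right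
      (torusMul_star_mem_suppOn_compl hq h3), map_zero, map_zero, sub_zero,
    Submodule.starProjection_eq_self_iff.2 (hq f (suppOn_mono Set.inter_subset_left hf)),
    ← torusMul_mul, hpq, torusMul_one]

/-- A self-adjoint operator vanishes on the orthogonal complement of its range. -/
theorem bsKernel_eq_zero (hdeg : ∀ j, p.degreeOf j ≤ n j) {g : Lp ℂ 2 (sigma ι)}
    (hg : g ∈ suppOn (nonnegOn S ∩ shortOn n S)ᶜ) : bsKernel p n S g = 0 := by
  refine (inner_self_eq_zero (𝕜 := ℂ)).1 ?_
  rw [inner_bsKernel_left]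
  exact inner_eq_zero_of_disjoint disjoint_compl_left hg (bsKernel_mem hdeg _)

/-- `bsKernel` is positive definite. -/
theorem eq_zero_of_inner_bsKernel (hdeg : ∀ j, p.degreeOf j ≤ n j) (hpq : polyMap p * q = 1)
    (hq : q ∈ multiplierAlgebra (suppOn (nonnegOn S)))
    {g : Lp ℂ 2 (sigma ι)} (hg : g ∈ suppOn (nonnegOn S ∩ shortOn n S))
    (h : ⟪g, bsKernel p n S g⟫_ℂ = 0) : g = 0 := by
  -- By the left inverse property, ‖q R g‖² = ⟨R g, |q|² R g⟩ = ⟨g, R g⟩ = 0.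
  have h1 : torusMul q (bsKernel p n S g) = 0 := by
    refine (inner_self_eq_zero (𝕜 := ℂ)).1 ?_
    rw [inner_torusMul_left, ← torusMul_mul, inner_bsKernel_left,
      bsKernel_torusMul hpq hq (bsKernel_mem hdeg g), h]
  have h2 : bsKernel p n S g = 0 := by
    rw [← torusMul_one (bsKernel p n S g), ← hpq, torusMul_mul, h1, map_zero]
  refine (inner_self_eq_zero (𝕜 := ℂ)).1 ?_
  nth_rewrite 2 [← bsKernel_torusMul hpq hq hg]
  rw [← inner_bsKernel_left, h2, inner_zero_left]

/-- A function in the span of the frequencies `XSet n S` that is orthogonal to the frequencies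
`XSet n S ∩ XSet n T` is orthogonal to all frequencies in `nonnegOn S ∩ shortOn n S ∩ shortOn n T`,
whatever their signs in the directions of `T`. -/
theorem inner_eq_zero_of_orthogonal (hdeg : ∀ j, p.degreeOf j ≤ n j) (hST : IsCompl S T)
    (hpq : polyMap p * q = 1) (hq : q ∈ multiplierAlgebra (suppOn (nonnegOn S)))
    {f : Lp ℂ 2 (sigma ι)} (hf : f ∈ suppOn (XSet n S))
    (hperp : ∀ h ∈ suppOn (XSet n S ∩ XSet n T), ⟪h, torusMul (star q * q) f⟫_ℂ = 0) :
    ∀ h ∈ suppOn (nonnegOn S ∩ shortOn n S ∩ shortOn n T),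
      ⟪h, torusMul (star q * q) f⟫_ℂ = 0 := by
  set g := torusMul (star q * q) f with hg
  set A := nonnegOn S ∩ shortOn n S with hA
  set N : Set (ι → ℤ) := {α | ∃ k ∈ T, α k < 0} with hN
  set L : Set (ι → ℤ) := {α | ∀ k ∈ T, n k ≤ α k} with hL
  have hcover : ∀ α, α ∈ nonnegOn S → α ∈ nonnegOn T → α ∈ nonnegOn Set.univ := by
    intro α h1 h2 k _
    have hk : k ∈ S ∪ T := by exact hST.codisjoint.top_le trivial
    exact hk.elim (h1 k) (h2 k)
  have hNL : Disjoint N L := Set.disjoint_left.2 fun α ⟨k, hk, hlt⟩ h => by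
    have := h k hk
    lia
  -- Frequencies of A outside N and L lie in X_S ∩ X_T, where the hypothesis applies.
  have hcoeff : ∀ α ∈ A, α ∉ N → α ∉ L → ⟪monomialBasis ι α, g⟫_ℂ = 0 := by
    intro α hα h1 h2
    simp only [hN, hL, Set.mem_ofPred_eq, not_exists, not_and, not_lt, not_forall, not_le] at h1 h2
    have h3 : α ∈ nonnegOn Set.univ := hcover α hα.1 h1
    obtain ⟨k, hk, hlt⟩ := h2
    refine hperp _ (monomialBasis_mem_suppOn ?_)
    rw [XSet_eq, XSet_eq]
    exact ⟨⟨h3, hα.2⟩, h3, k, hk, hlt⟩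
  set g₁ := (suppOn (A ∩ N)).starProjection g with hg₁
  set g₂ := (suppOn (A ∩ L)).starProjection g with hg₂
  have hg₁mem : g₁ ∈ suppOn (A ∩ N) := Submodule.starProjection_apply_mem _ _
  have hg₂mem : g₂ ∈ suppOn (A ∩ L) := Submodule.starProjection_apply_mem _ _
  have hrest : g - g₁ - g₂ ∈ suppOn Aᶜ := mem_suppOn.2 fun α hα => by
    rw [Set.notMem_compl_iff] at hα
    rw [inner_sub_right, inner_sub_right]
    by_cases h1 : α ∈ N
    · rw [hg₁, hg₂, inner_monomialBasis_proj_of_mem g (show α ∈ A ∩ N from ⟨hα, h1⟩),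
        inner_monomialBasis_proj_of_notMem g fun h => Set.disjoint_left.1 hNL h1 h.2]
      ring
    by_cases h2 : α ∈ L
    · rw [hg₁, hg₂, inner_monomialBasis_proj_of_mem g (show α ∈ A ∩ L from ⟨hα, h2⟩),
        inner_monomialBasis_proj_of_notMem g fun h => h1 h.2]
      ring
    · rw [hcoeff α hα h1 h2, mem_suppOn.1 hg₁mem α fun h => h1 h.2,
        mem_suppOn.1 hg₂mem α fun h => h2 h.2]
      ring
  have hfA : f ∈ suppOn A := by
    refine suppOn_mono ?_ hf
    rw [XSet_eq]
    exact fun α hα => ⟨fun k _ => hα.1 k trivial, hα.2⟩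
  -- R annihilates the part of `g` off A, and R g = f.
  have hRg : bsKernel p n S g₁ = f - bsKernel p n S g₂ := by
    have h := bsKernel_eq_zero hdeg hrest
    rw [map_sub, map_sub, hg, bsKernel_torusMul hpq hq hfA] at h
    rw [← sub_eq_zero, ← neg_eq_zero, ← h]
    abel
  have hRT : bsKernel p n S g₁ ∈ suppOn (nonnegOn T) := by
    rw [hRg]
    refine Submodule.sub_mem _ (suppOn_mono ?_ hf) (bsKernel_mem_nonnegOn hdeg hST.disjoint
      (suppOn_mono Set.inter_subset_right hg₂mem))
    rw [XSet_eq]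
    exact fun α hα k _ => hα.1 k trivial
  -- Each frequency of g₁ is negative somewhere on T, while R g₁ is analytic on T; thus ⟨g₁, R g₁⟩ =
  -- 0.
  have hg₁0 : g₁ = 0 := by
    refine eq_zero_of_inner_bsKernel hdeg hpq hq (suppOn_mono Set.inter_subset_left hg₁mem) ?_
    refine inner_eq_zero_of_disjoint (Set.disjoint_left.2 ?_)
      (suppOn_mono Set.inter_subset_right hg₁mem) hRT
    rintro α ⟨k, hk, hlt⟩ h
    exact (h k hk).not_gt hlt
  intro h hh
  refine inner_eq_zero_of_forall fun α => ?_
  by_cases hα : α ∈ A ∩ shortOn n T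
  · right
    by_cases h1 : α ∈ N
    · rw [← inner_monomialBasis_proj_of_mem g (show α ∈ A ∩ N from ⟨hα.1, h1⟩), ← hg₁, hg₁0,
        inner_zero_right]
    · refine hcoeff α hα.1 h1 fun h2 => ?_
      obtain ⟨k, hk, hlt⟩ := hα.2
      exact (h2 k hk).not_gt hlt
  · exact .inl (mem_suppOn.1 hh α hα)

end Inverse

/-! ### Transfer from `L²(σ)` to `L²(μ)` -/

section Transfer

variable {p : MvPolynomial ι ℂ} {q : C(UnitAddTorus ι, ℂ)}

theorem memLp_sigma (f : Lp ℂ 2 (bsMeasure p)) : MemLp f 2 (sigma ι) := by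
  obtain ⟨c, h0, ht, hle⟩ := exists_smul_sigma_le p
  have h := ((Lp.memLp f).mono_measure hle).smul_measure (ENNReal.inv_ne_top.2 h0)
  rwa [smul_smul, ENNReal.inv_mul_cancel h0 ht, one_smul] at h

/-- An element of `L²(μ)` as an element of `L²(σ)`. -/
def toSigma (f : Lp ℂ 2 (bsMeasure p)) : Lp ℂ 2 (sigma ι) := (memLp_sigma f).toLp f

theorem coeFn_toSigma (f : Lp ℂ 2 (bsMeasure p)) : toSigma f =ᵐ[sigma ι] f :=
  MemLp.coeFn_toLp _

theorem mem_L2_iff {X : Set (ι → ℤ)} {f : Lp ℂ 2 (bsMeasure p)} :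
    f ∈ L2 p X ↔ toSigma f ∈ suppOn X := by
  rw [mem_suppOn]
  refine forall₂_congr fun α _ => ?_
  rw [inner_monomialBasis, mFourierCoeff_eq, mFourierCoeff_eq]
  refine Eq.congr_left (integral_congr_ae ?_)
  filter_upwards [coeFn_toSigma f] with t ht
  rw [ht]

theorem weight_eq (hpq : polyMap p * q = 1) (t : UnitAddTorus ι) : weight p t = ‖q t‖ₑ ^ 2 := by
  have h : MvPolynomial.eval (coord t) p * q t = 1 := by
    rw [← polyMap_apply]
    exact DFunLike.congr_fun hpq t
  rw [weight, eq_inv_of_mul_eq_one_left h, enorm_inv (right_ne_zero_of_mul_eq_one h),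
    ENNReal.inv_pow, inv_inv]

/-- Together with `exists_smul_sigma_le`, this shows that L²(μ) and L²(σ) consist of the same
functions. -/
theorem bsMeasure_le (hpq : polyMap p * q = 1) : bsMeasure p ≤ (‖q‖ₑ ^ 2) • sigma ι := by
  rw [bsMeasure, ← withDensity_const]
  refine withDensity_mono (Filter.Eventually.of_forall fun t => ?_)
  rw [weight_eq hpq]
  refine pow_le_pow_left' ?_ 2
  rw [enorm_le_iff_norm_le]
  exact q.norm_coe_le_norm t

theorem exists_toSigma_eq (hpq : polyMap p * q = 1) (h : Lp ℂ 2 (sigma ι)) :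
    ∃ f : Lp ℂ 2 (bsMeasure p), toSigma f = h := by
  have hmem : MemLp h 2 (bsMeasure p) :=
    ((Lp.memLp h).smul_measure (c := ‖q‖ₑ ^ 2) (by simp)).mono_measure (bsMeasure_le hpq)
  refine ⟨hmem.toLp h, Lp.ext ?_⟩
  exact (coeFn_toSigma _).trans ((sigma_absolutelyContinuous p).ae_le hmem.coeFn_toLp)

theorem inner_eq_inner_toSigma (hpq : polyMap p * q = 1) (f g : Lp ℂ 2 (bsMeasure p)) :
    ⟪f, g⟫_ℂ = ⟪toSigma f, torusMul (star q * q) (toSigma g)⟫_ℂ := by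
  have hw : weight p = fun t => ‖q t‖ₑ ^ 2 := funext (weight_eq hpq)
  rw [L2.inner_def, L2.inner_def]
  refine (integral_withDensity_eq_integral_toReal_smul (μ := sigma ι) (f := weight p)
    (by rw [hw]; exact q.continuous.measurable.enorm.pow_const 2)
    (Filter.Eventually.of_forall fun t => by rw [hw]; simp) _).trans (integral_congr_ae ?_)
  filter_upwards [coeFn_toSigma f, coeFn_toSigma g, coeFn_torusMul (star q * q) (toSigma g)]
    with t h1 h2 h3
  rw [h1, h3, h2, hw, ENNReal.toReal_pow, toReal_enorm, Complex.real_smul, Complex.ofReal_pow,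
    ← Complex.mul_conj']
  simp only [RCLike.inner_apply, ContinuousMap.mul_apply, ContinuousMap.star_apply, RCLike.star_def]
  ring

theorem toSigma_mulVar [DecidableEq ι] (j : ι) (f : Lp ℂ 2 (bsMeasure p)) :
    toSigma (mulVar j f) = torusMul (mFourier (Pi.single j 1)) (toSigma f) := by
  refine Lp.ext ?_
  filter_upwards [coeFn_toSigma (mulVar j f), coeFn_toSigma f,
    coeFn_torusMul (mFourier (Pi.single j 1)) (toSigma f),
    (sigma_absolutelyContinuous p).ae_le (memLp_mul j f).coeFn_toLp] with t h1 h2 h3 h4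
  rw [h1, h3, h2, ← coord_eq_mFourier]
  exact h4

end Transfer

/-! ### Invariance under multiplication by the variables of T -/

theorem mulVar_mem_L2Diff {p : MvPolynomial ι ℂ} {n : ι → ℕ} (hdeg : ∀ j, p.degreeOf j ≤ n j)
    (hp : ∀ z : ι → ℂ, (∀ j, ‖z j‖ ≤ 1) → MvPolynomial.eval z p ≠ 0)
    {S T : Set ι} (hST : IsCompl S T) {j : ι} (hj : j ∈ T) {f : Lp ℂ 2 (bsMeasure p)}
    (hf : f ∈ L2Diff p (XSet n S) (XSet n S ∩ XSet n T)) :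
    mulVar j f ∈ L2Diff p (XSet n S) (XSet n S ∩ XSet n T) := by
  classical
  obtain ⟨q, hq, hpq⟩ := exists_inverse_mem_multiplierAlgebra hp
    (isClosed_suppOn (nonnegOn S)) fun i f hf => by
      rw [polyMap_X]
      refine torusMul_mFourier_mem (fun α hα k hk => ?_) hf
      have h1 : (0 : ι → ℤ) ≤ Pi.single i 1 := Pi.single_nonneg.2 zero_le_one
      exact add_nonneg (h1 k) (hα k hk)
  have hfS : toSigma f ∈ suppOn (XSet n S) := mem_L2_iff.1 hf.1
  have hperp := inner_eq_zero_of_orthogonal hdeg hST hpq hq hfS fun h hh => by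
    obtain ⟨g, rfl⟩ := exists_toSigma_eq hpq h
    rw [← inner_eq_inner_toSigma hpq]
    exact (Submodule.mem_orthogonal _ _).1 hf.2 g (mem_L2_iff.2 hh)
  refine ⟨mem_L2_iff.2 ?_, (Submodule.mem_orthogonal _ _).2 fun g hg => ?_⟩
  · rw [toSigma_mulVar]
    refine torusMul_mFourier_mem ?_ hfS
    rintro α ⟨h0, k, hk, hlt⟩
    refine ⟨add_nonneg (Pi.single_nonneg.2 zero_le_one) h0, k, hk, ?_⟩
    have hkj : k ≠ j := fun h => Set.disjoint_left.1 hST.disjoint hk (h ▸ hj)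
    rwa [Pi.add_apply, Pi.single_eq_of_ne hkj, zero_add]
  · rw [inner_eq_inner_toSigma hpq, toSigma_mulVar, ← torusMul_mul, mul_comm, torusMul_mul,
      inner_torusMul_right, star_mFourier]
    -- Division by z_j may produce the frequency -1 in direction j. It leaves the S-frequencies
    -- unchanged and keeps a short T-frequency short, which is all that `hperp` requires.
    refine hperp _ (torusMul_mFourier_mem ?_ (mem_L2_iff.1 hg))
    rintro α ⟨⟨h0, k, hk, hlt⟩, -, l, hl, hlt'⟩
    have hS : ∀ i ∈ S, (-Pi.single j 1 + α : ι → ℤ) i = α i := fun i hi => by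
      have hij : i ≠ j := fun h => Set.disjoint_left.1 hST.disjoint hi (h ▸ hj)
      rw [Pi.add_apply, Pi.neg_apply, Pi.single_eq_of_ne hij, neg_zero, zero_add]
    refine ⟨⟨fun i hi => (h0 i).trans_eq (hS i hi).symm, k, hk, (hS k hk).trans_lt hlt⟩, l, hl, ?_⟩
    have h1 : (0 : ι → ℤ) ≤ Pi.single j 1 := Pi.single_nonneg.2 zero_le_one
    have h2 : 0 ≤ (Pi.single j 1 : ι → ℤ) l := h1 l
    rw [Pi.add_apply, Pi.neg_apply]
    lia

end BernsteinSzego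

end

theorem mainTheorem4 (d : ℕ) (p : MvPolynomial (Fin d) ℂ) (n : Fin d → ℕ)
    (hdeg : ∀ j, p.degreeOf j ≤ n j)
    (hp : ∀ z : Fin d → ℂ, (∀ j, ‖z j‖ ≤ 1) → MvPolynomial.eval z p ≠ 0)
    (S T : Set (Fin d)) (hST : IsCompl S T) (j : Fin d) (hj : j ∈ T) :
    ∀ f ∈ BernsteinSzego.L2Diff p (BernsteinSzego.XSet n S)
        (BernsteinSzego.XSet n S ∩ BernsteinSzego.XSet n T),
      BernsteinSzego.mulVar j f ∈ BernsteinSzego.L2Diff p (BernsteinSzego.XSet n S)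
        (BernsteinSzego.XSet n S ∩ BernsteinSzego.XSet n T) := by
  exact fun _ hf => BernsteinSzego.mulVar_mem_L2Diff hdeg hp hST hj hf
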